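/- Let $(M,g)$ be a closed (compact, without boundary), connected, smooth Riemannian manifold, and let $L:TM\to\mathbb R$ be a Tonelli Lagrangian, i.e. a smooth function whose second fibre derivative $d_{vv}L$ is everywhere positive definite and which is superlinear on each fibre. Assume that $L$ is quadratic at infinity, in the sense that $L$ is bounded below by $a'|v|^2-b'$ and above by $A'|v|^2+B'$ for some constants with $a'>0$, and that $a>0$ is such that $d_{vv}L(q,v)[u,u]\ge 2a|u|^2$ for all $q\in M$ and $u,v\in T_qM$. Let $Q_0,Q_1\subseteq M$ be non-empty closed submanifolds. For an $H^1$-path $x:[0,1]\to M$, $T>0$ and $k\in\mathbb R$ put $$S_k(x,T)=T\int_0^1\Big[L\Big(x(s),\frac{x'(s)}{T}\Big)+k\Big]\,ds ,$$ and let $E(q,v)=d_vL(q,v)[v]-L(q,v)$ be the energy. Set (infima are taken in $[-\infty,+\infty]$) * $e_0(L)=\max_{q\in M}E(q,0)$; * $c(L)=\inf\{k\in\mathbb R : S_k(x,T)\ge 0 \text{ for all closed } H^1\text{-loops } x \text{ in } M \text{ and all } T>0\}$, and in the same way $c(L_1)$ for the lift $L_1=L\circ dp$ of $L$ to a covering $p:M_1\to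 M$ (with loops in $M_1$); * $c_u(L)=\inf\{k\in\mathbb R : S_k(x,T)\ge 0 \text{ for all contractible closed } H^1\text{-loops } x \text{ in } M \text{ and all } T>0\}$; * $c(L;Q_0,Q_1)=c(L_1)$, where $M_1=\widetilde M/\langle G_0,G_1\rangle$, $\widetilde M$ is the universal covering of $M$ and $G_i$ is the smallest normal subgroup of $\pi_1(M)$ containing the image of $\pi_1(Q_i)$ under the inclusion (of every component, if $Q_i$ is not connected; $\pi_1(M)$ is taken at an arbitrary base point and loops in $Q_i$ are transported to it along paths in $M$); * $k_0(L)=\inf\{k\in\mathbb R : S_k(x,T)\ge 0 \text{ for all } H^1\text{-paths } x \text{ from } Q_0 \text{ to } Q_1 \text{ and all } T>0\}$; * $\theta_q=d_vL(q,0)\in T_q^*M$ and $\|\theta\|_\infty=\max_{q\in M}|\theta_q|$, where $|\cdot|$ is the dual norm. Then $$e_0(L)\le c_u(L)\le c(L;Q_0,Q_1)\le c(L)\le k_0(L)\le e_0(L)+\frac{\|\theta\|_\infty^2}{4a}.$$ In particular, if $\theta\equiv 0$, and therefore if $L$ is a mechanical Lagrangian $L(q,v)=\frac12|v|^2-V(q)$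 with $V$ smooth, then $$e_0(L)=c_u(L)=c(L;Q_0,Q_1)=c(L)=k_0(L).$$ -/

import Mathlib

open Set Manifold MeasureTheory
open scoped ContDiff Topology Bundle unitInterval

noncomputable section

namespace ManeChain

/-! ### Coverings of a manifold attached to subgroups of its fundamental group -/

section Covering

variable {M : Type*} [TopologicalSpace M] {m : M}

/-- Two homotopy classes of paths from `m` to `q` are identified when the loop `a * b⁻¹` represents
an element of `G`. -/
def pathSetoid (G : Subgroup (FundamentalGroup M m)) (q : M) :
    Setoid (Path.Homotopic.Quotient m q) where
  r a b := FundamentalGroup.fromPath (a.trans b.symm) ∈ G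
  iseqv :=
    { refl := fun a => by
        rw [Path.Homotopic.Quotient.trans_symm]
        exact G.one_mem
      symm := fun {a b} h => by
        have h' := G.inv_mem h
        rw [FundamentalGroup.inv_def] at h'
        induction a using Path.Homotopic.Quotient.ind with | _ a =>
        induction b using Path.Homotopic.Quotient.ind with | _ b =>
        have e : (Path.Homotopic.Quotient.mk a).trans (Path.Homotopic.Quotient.mk b).symm
            = Path.Homotopic.Quotient.mk (a.trans b.symm) := rfl
        have e' : (Path.Homotopic.Quotient.mk (a.trans b.symm)).symm
            = Path.Homotopic.Quotient.mk ((a.trans b.symm).symm) := rfl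
        have e'' : (Path.Homotopic.Quotient.mk b).trans (Path.Homotopic.Quotient.mk a).symm
            = Path.Homotopic.Quotient.mk (b.trans a.symm) := rfl
        rw [e, e', Path.trans_symm, Path.symm_symm] at h'
        rw [e'']
        exact h'
      trans := fun {a b c} h h' => by
        have h'' := G.mul_mem h' h
        rw [FundamentalGroup.mul_def] at h''
        have : (a.trans b.symm).trans (b.trans c.symm) = a.trans c.symm := by
          rw [Path.Homotopic.Quotient.trans_assoc,
            ← Path.Homotopic.Quotient.trans_assoc b.symm b c.symm,
            Path.Homotopic.Quotient.symm_trans, Path.Homotopic.Quotient.refl_trans]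
        rw [← this]
        exact h'' }

/-- The covering `M̃ / G` of `M`, where `M̃` is the universal covering, realized as the set of pairs
`(q, [a])` with `[a]` the homotopy class of a path from the base point to `q`. -/
structure Cover (G : Subgroup (FundamentalGroup M m)) where
  /-- The covering projection. -/
  proj : M
  /-- The class of a path from the base point. -/
  cls : Quotient (pathSetoid G proj)

variable {G : Subgroup (FundamentalGroup M m)}

/-- Moving a point of the covering along (the lift of) a path of `M`. -/
def Cover.move (x : Cover G) {q : M} (δ : Path x.proj q) : Cover G :=
  ⟨q, Quotient.map' (s₁ := pathSetoid G x.proj) (s₂ := pathSetoid G q)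
    (fun a => a.trans (Path.Homotopic.Quotient.mk δ))
    (fun a b h => by
      change FundamentalGroup.fromPath (a.trans b.symm) ∈ G at h
      change FundamentalGroup.fromPath ((a.trans (Path.Homotopic.Quotient.mk δ)).trans
        (b.trans (Path.Homotopic.Quotient.mk δ)).symm) ∈ G
      have : (b.trans (Path.Homotopic.Quotient.mk δ)).symm
          = (Path.Homotopic.Quotient.mk δ).symm.trans b.symm := by
        induction b using Path.Homotopic.Quotient.ind with | _ b =>
        change Path.Homotopic.Quotient.mk ((b.trans δ).symm)
          = Path.Homotopic.Quotient.mk (δ.symm.trans b.symm)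
        rw [Path.trans_symm]
      rw [this, Path.Homotopic.Quotient.trans_assoc,
        ← Path.Homotopic.Quotient.trans_assoc (Path.Homotopic.Quotient.mk δ),
        Path.Homotopic.Quotient.trans_symm, Path.Homotopic.Quotient.refl_trans]
      exact h) x.cls⟩

theorem Cover.move_trans (x : Cover G) {q q' : M} (δ : Path x.proj q) (δ' : Path q q') :
    (x.move δ).move (q := q') δ' = x.move (δ.trans δ') := by
  obtain ⟨p, a⟩ := x
  induction a using Quotient.inductionOn with | _ a =>
  refine congrArg (Cover.mk (G := G) q') (congrArg (Quotient.mk (pathSetoid G q')) ?_)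
  exact Path.Homotopic.Quotient.trans_assoc _ _ _

theorem Cover.move_refl (x : Cover G) : x.move (Path.refl x.proj) = x := by
  obtain ⟨p, a⟩ := x
  induction a using Quotient.inductionOn with | _ a =>
  refine congrArg (Cover.mk (G := G) p) (congrArg (Quotient.mk (pathSetoid G p)) ?_)
  exact Path.Homotopic.Quotient.trans_refl _

theorem Cover.move_congr (x : Cover G) {q : M} {δ δ' : Path x.proj q} (h : δ.Homotopic δ') :
    x.move δ = x.move δ' := by
  obtain ⟨p, a⟩ := x
  induction a using Quotient.inductionOn with | _ a =>
  refine congrArg (Cover.mk (G := G) q) (congrArg (Quotient.mk (pathSetoid G q)) ?_)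
  exact congrArg a.trans (Path.Homotopic.Quotient.eq.2 h)

/-- The usual topology of the covering: a set is open when with every point it contains all points
obtained by moving along the paths of some neighbourhood. -/
instance : TopologicalSpace (Cover G) where
  IsOpen W := ∀ x ∈ W, ∃ U : Set M, IsOpen U ∧ x.proj ∈ U ∧
    ∀ (q : M) (δ : Path x.proj q), range δ ⊆ U → x.move δ ∈ W
  isOpen_univ := fun _ _ => ⟨univ, isOpen_univ, mem_univ _, fun _ _ _ => mem_univ _⟩
  isOpen_inter := fun W W' h h' x hx => by
    obtain ⟨U, hU, hxU, hW⟩ := h x hx.1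
    obtain ⟨U', hU', hxU', hW'⟩ := h' x hx.2
    exact ⟨U ∩ U', hU.inter hU', ⟨hxU, hxU'⟩, fun q δ hδ =>
      ⟨hW q δ (hδ.trans inter_subset_left), hW' q δ (hδ.trans inter_subset_right)⟩⟩
  isOpen_sUnion := fun S h x ⟨W, hWS, hxW⟩ => by
    obtain ⟨U, hU, hxU, hW⟩ := h W hWS x hxW
    exact ⟨U, hU, hxU, fun q δ hδ => ⟨W, hWS, hW q δ hδ⟩⟩

/-- The part of the covering that is reached from `x` along paths in `U`. -/
def Cover.sheet (x : Cover G) (U : Set M) : Set (Cover G) :=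
  {y | ∃ (q : M) (δ : Path x.proj q), range δ ⊆ U ∧ y = x.move δ}

theorem Cover.isOpen_sheet (x : Cover G) {U : Set M} (hU : IsOpen U) : IsOpen (x.sheet U) := by
  rintro _ ⟨q, δ, hδ, rfl⟩
  refine ⟨U, hU, hδ ⟨1, δ.target⟩, fun q' δ' hδ' => ⟨q', δ.trans δ', ?_, ?_⟩⟩
  · exact (Path.trans_range (γ₁ := δ) (γ₂ := δ')).trans_subset (union_subset hδ hδ')
  · exact x.move_trans δ δ'

theorem Cover.mem_sheet (x : Cover G) {U : Set M} (hx : x.proj ∈ U) : x ∈ x.sheet U :=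
  ⟨x.proj, Path.refl _, by
    rintro _ ⟨t, rfl⟩
    exact hx, x.move_refl.symm⟩

theorem Cover.continuous_proj : Continuous (Cover.proj : Cover G → M) where
  isOpen_preimage V hV _ hx := ⟨V, hV, hx, fun _ δ hδ => hδ ⟨1, δ.target⟩⟩

theorem Cover.isOpenMap_proj [LocallyPathConnectedSpace M] :
    IsOpenMap (Cover.proj : Cover G → M) := by
  intro W hW
  rw [isOpen_iff_mem_nhds]
  rintro _ ⟨x, hx, rfl⟩
  obtain ⟨U, hU, hxU, h⟩ := hW x hx
  filter_upwards [pathComponentIn_mem_nhds (hU.mem_nhds hxU)] with q hq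
  obtain ⟨δ, hδ⟩ := hq
  exact ⟨x.move δ, h q δ (by rintro _ ⟨t, rfl⟩; exact hδ t), rfl⟩

theorem Cover.isLocalHomeomorph_proj [LocallyPathConnectedSpace M]
    (hM : ∀ q : M, ∃ U : Set M, IsOpen U ∧ q ∈ U ∧ ∀ (q' : M) (δ δ' : Path q q'),
      range δ ⊆ U → range δ' ⊆ U → δ.Homotopic δ') :
    IsLocalHomeomorph (Cover.proj : Cover G → M) := by
  rw [isLocalHomeomorph_iff_isOpenEmbedding_restrict]
  intro x
  obtain ⟨U, hU, hxU, h⟩ := hM x.proj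
  have hS := x.isOpen_sheet hU
  refine ⟨x.sheet U, hS.mem_nhds (x.mem_sheet hxU), ?_⟩
  refine Topology.IsOpenEmbedding.of_continuous_injective_isOpenMap
    (Cover.continuous_proj.comp continuous_subtype_val) ?_
    (Cover.isOpenMap_proj.comp hS.isOpenMap_subtype_val)
  rintro ⟨_, q, δ, hδ, rfl⟩ ⟨_, q', δ', hδ', rfl⟩ hqq
  obtain rfl : q = q' := hqq
  exact Subtype.ext (x.move_congr (h q δ δ' hδ hδ'))

end Covering

section CoveringManifold

variable {E : Type*} [NormedAddCommGroup E] [NormedSpace ℝ E]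
  {M : Type*} [TopologicalSpace M] [ChartedSpace E M] {m : M}

theorem exists_isOpen_homotopic (E : Type*) [NormedAddCommGroup E] [NormedSpace ℝ E]
    {M : Type*} [TopologicalSpace M] [ChartedSpace E M] (q : M) : ∃ U : Set M, IsOpen U ∧ q ∈ U ∧
    ∀ (q' : M) (δ δ' : Path q q'), range δ ⊆ U → range δ' ⊆ U → δ.Homotopic δ' := by
  set e := chartAt E q with he
  have hq : q ∈ e.source := mem_chart_source E q
  obtain ⟨r, hr, hball⟩ := Metric.isOpen_iff.1 e.open_target (e q) (e.map_source hq)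
  set B := Metric.ball (e q) r
  refine ⟨e.source ∩ e ⁻¹' B, e.isOpen_inter_preimage Metric.isOpen_ball,
    ⟨hq, Metric.mem_ball_self hr⟩, ?_⟩
  intro q' δ δ' hδ hδ'
  have : ContractibleSpace B :=
    (convex_ball (e q) r).contractibleSpace ⟨e q, Metric.mem_ball_self hr⟩
  have hf : Continuous (fun y : B => e.symm y) :=
    e.continuousOn_symm.comp_continuous continuous_subtype_val fun y => hball y.2
  have hq' : q' ∈ e.source ∩ e ⁻¹' B := hδ ⟨1, δ.target⟩
  have key : ∀ η : Path q q', range η ⊆ e.source ∩ e ⁻¹' B →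
      ∃ κ : Path (⟨e q, Metric.mem_ball_self hr⟩ : B) ⟨e q', hq'.2⟩,
        η = (κ.map hf).cast (e.left_inv hq).symm (e.left_inv hq'.1).symm := by
    intro η hη
    refine ⟨⟨⟨fun t => ⟨e (η t), (hη ⟨t, rfl⟩).2⟩, ?_⟩, ?_, ?_⟩, ?_⟩
    · exact Continuous.subtype_mk
        (e.continuousOn.comp_continuous η.continuous fun t => (hη ⟨t, rfl⟩).1) _
    · simp
    · simp
    · ext t
      exact (e.left_inv (hη ⟨t, rfl⟩).1).symm
  obtain ⟨κ, hκ⟩ := key δ hδ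
  obtain ⟨κ', hκ'⟩ := key δ' hδ'
  rw [hκ, hκ']
  exact ((SimplyConnectedSpace.paths_homotopic κ κ').map ⟨_, hf⟩).pathCast _ _

variable {G : Subgroup (FundamentalGroup M m)}

theorem Cover.isLocalHomeomorph (E : Type*) [NormedAddCommGroup E] [NormedSpace ℝ E]
    {M : Type*} [TopologicalSpace M] [ChartedSpace E M] {m : M}
    {G : Subgroup (FundamentalGroup M m)} : IsLocalHomeomorph (Cover.proj : Cover G → M) :=
  have := ChartedSpace.locallyPathConnectedSpace E M
  Cover.isLocalHomeomorph_proj (exists_isOpen_homotopic E)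

/-- The smooth structure of the covering: its charts are the charts of `M` composed with local
restrictions of the projection. -/
instance : ChartedSpace E (Cover G) where
  atlas := range fun x : Cover G =>
    (Classical.choose (Cover.isLocalHomeomorph E x)).trans (chartAt E x.proj)
  chartAt x := (Classical.choose (Cover.isLocalHomeomorph E x)).trans (chartAt E x.proj)
  mem_chart_source x := by
    have h := Classical.choose_spec (Cover.isLocalHomeomorph E x)
    simp only [OpenPartialHomeomorph.trans_source, mem_inter_iff, mem_preimage]
    refine ⟨h.1, ?_⟩
    rw [← h.2]
    exact mem_chart_source E x.proj
  chart_mem_atlas x := mem_range_self x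

instance [IsManifold 𝓘(ℝ, E) ∞ M] : IsManifold 𝓘(ℝ, E) ∞ (Cover G) where
  compatible := by
    rintro _ _ ⟨x, rfl⟩ ⟨y, rfl⟩
    have hx := (Classical.choose_spec (Cover.isLocalHomeomorph E x)).2
    have hy := (Classical.choose_spec (Cover.isLocalHomeomorph E y)).2
    dsimp only
    generalize Classical.choose (Cover.isLocalHomeomorph E x) = e at hx ⊢
    generalize Classical.choose (Cover.isLocalHomeomorph E y) = e' at hy ⊢
    set φ := chartAt E x.proj
    set φ' := chartAt E y.proj
    have hφ : φ.symm.trans φ' ∈ contDiffGroupoid ∞ 𝓘(ℝ, E) :=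
      HasGroupoid.compatible (chart_mem_atlas E _) (chart_mem_atlas E _)
    set F := (e.trans φ).symm.trans (e'.trans φ') with hF
    have key : ∀ z ∈ F.source, e' (e.symm (φ.symm z)) = φ.symm z := by
      intro z hz
      have h1 : φ.symm z ∈ e.target := by
        simp only [hF, mfld_simps] at hz
        tauto
      rw [← hy, hx]
      exact e.right_inv h1
    refine StructureGroupoid.mem_of_eqOnSource _
      (closedUnderRestriction' hφ F.open_source) ⟨?_, ?_⟩
    · ext z
      simp only [OpenPartialHomeomorph.restr_source, F.open_source.interior_eq, mem_inter_iff]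
      refine ⟨fun hz => ⟨?_, hz⟩, fun hz => hz.2⟩
      have hk := key z hz
      simp only [hF, mfld_simps] at hz ⊢
      rw [← hk]
      rw [hk] at hz ⊢
      tauto
    · intro z hz
      exact congrArg φ' (key z hz)

end CoveringManifold

/-! ### Paths of class `H¹` and the free-time action -/

section Action

variable {E : Type*} [NormedAddCommGroup E] [NormedSpace ℝ E]
  {N : Type*} [TopologicalSpace N] [ChartedSpace E N]

/-- `f` is (continuous and) of Sobolev class `H¹ = W^{1,2}` on `[a, b]`. -/
def IsH1On (f : ℝ → E) (a b : ℝ) : Prop :=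
  ∃ g : ℝ → E, MemLp g 2 (volume.restrict (Icc a b)) ∧
    ∀ t ∈ Icc a b, f t = f a + ∫ s in a..t, g s

/-- A path `[0,1] → N` is of class `H¹` if it is so locally in charts (the path is extended by
constants outside `[0,1]`). -/
def IsH1 {q q' : N} (γ : Path q q') : Prop :=
  ∀ t ∈ Icc (0 : ℝ) 1, ∃ ε > 0,
    MapsTo γ.extend (Icc (t - ε) (t + ε)) (chartAt E (γ.extend t)).source ∧
    IsH1On (fun s => chartAt E (γ.extend t) (γ.extend s)) (t - ε) (t + ε)

/-- The velocity `γ'(s)`; it exists for almost every `s ∈ [0,1]` if `γ` is of class `H¹`. -/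
def velocity {q q' : N} (γ : Path q q') (s : ℝ) : TangentSpace 𝓘(ℝ, E) (γ.extend s) :=
  mfderiv 𝓘(ℝ, ℝ) 𝓘(ℝ, E) γ.extend s (1 : ℝ)

/-- The free-time action `S_k(γ, T) = T ∫₀¹ [L(γ(s), γ'(s) / T) + k] ds`. -/
def action (L : TangentBundle 𝓘(ℝ, E) N → ℝ) (k : ℝ) {q q' : N} (γ : Path q q') (T : ℝ) : ℝ :=
  T * ∫ s in (0 : ℝ)..1, (L ⟨γ.extend s, T⁻¹ • velocity γ s⟩ + k)

/-! ### The critical values. Infima are taken in the extended real line. -/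

/-- The Mañé critical value `c(L)` of a Lagrangian on a (not necessarily compact) manifold. -/
def criticalValue (L : TangentBundle 𝓘(ℝ, E) N → ℝ) : EReal :=
  sInf (Real.toEReal '' {k : ℝ | ∀ (q : N) (γ : Path q q), IsH1 (E := E) γ →
    ∀ T > 0, 0 ≤ action L k γ T})

/-- The Mañé critical value of the universal cover `c_u(L)`, through contractible loops. -/
def criticalValueUniversal (L : TangentBundle 𝓘(ℝ, E) N → ℝ) : EReal :=
  sInf (Real.toEReal '' {k : ℝ | ∀ (q : N) (γ : Path q q), IsH1 (E := E) γ →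
    γ.Homotopic (Path.refl q) → ∀ T > 0, 0 ≤ action L k γ T})

/-- The value `k₀(L)`, through all paths from `Q₀` to `Q₁`. -/
def criticalValuePaths (L : TangentBundle 𝓘(ℝ, E) N → ℝ) (Q₀ Q₁ : Set N) : EReal :=
  sInf (Real.toEReal '' {k : ℝ | ∀ q₀ ∈ Q₀, ∀ q₁ ∈ Q₁, ∀ γ : Path q₀ q₁, IsH1 (E := E) γ →
    ∀ T > 0, 0 ≤ action L k γ T})

/-- The smallest normal subgroup of `π₁(N, m)` that contains the image of `π₁(Q)`, transported to
the base point `m` along arbitrary paths. -/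
def inclusionSubgroup (m : N) (Q : Set N) : Subgroup (FundamentalGroup N m) :=
  Subgroup.normalClosure (⋃ (q : Q) (η : Path (q : N) m),
    FundamentalGroup.fundamentalGroupMulEquivOfPath η ''
      range (FundamentalGroup.map (⟨Subtype.val, continuous_subtype_val⟩ : C(Q, N)) q))

/-- The lift `L ∘ dp` of `L` to the covering attached to `G`. -/
def liftLagrangian (L : TangentBundle 𝓘(ℝ, E) N → ℝ) {m : N}
    (G : Subgroup (FundamentalGroup N m)) : TangentBundle 𝓘(ℝ, E) (Cover G) → ℝ :=
  fun v => L (tangentMap 𝓘(ℝ, E) 𝓘(ℝ, E) Cover.proj v)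

/-- The Mañé critical value `c(L; Q₀, Q₁)` of the pair `Q₀, Q₁`: the critical value of the lift of
`L` to the covering `Ñ / ⟨G₀, G₁⟩`, where `m` is the base point of the fundamental group. -/
def criticalValuePair (L : TangentBundle 𝓘(ℝ, E) N → ℝ) (m : N) (Q₀ Q₁ : Set N) : EReal :=
  criticalValue (liftLagrangian L (inclusionSubgroup m Q₀ ⊔ inclusionSubgroup m Q₁))

end Action

/-! ### Tonelli Lagrangians and submanifolds -/

section Tonelli

variable {E : Type*} [NormedAddCommGroup E] [NormedSpace ℝ E]
  {M : Type*} [TopologicalSpace M] [ChartedSpace E M] [IsManifold 𝓘(ℝ, E) ∞ M]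
  [Bundle.RiemannianBundle (fun x : M => TangentSpace 𝓘(ℝ, E) x)]

/-- The fibre derivative `d_v L(q, v)`. -/
def fiberDeriv (L : TangentBundle 𝓘(ℝ, E) M → ℝ) (q : M) (v : TangentSpace 𝓘(ℝ, E) q) :
    TangentSpace 𝓘(ℝ, E) q →L[ℝ] ℝ :=
  fderiv ℝ (fun w : TangentSpace 𝓘(ℝ, E) q => L ⟨q, w⟩) v

/-- The second fibre derivative `d_vv L(q, v)[u, w]`. -/
def fiberHess (L : TangentBundle 𝓘(ℝ, E) M → ℝ) (q : M) (v u w : TangentSpace 𝓘(ℝ, E) q) : ℝ :=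
  fderiv ℝ (fiberDeriv L q) v u w

/-- Tonelli Lagrangians: smooth, fibrewise `C²`-strictly convex and superlinear. -/
structure IsTonelli (L : TangentBundle 𝓘(ℝ, E) M → ℝ) : Prop where
  smooth : ContMDiff 𝓘(ℝ, E).tangent 𝓘(ℝ, ℝ) ∞ L
  convex : ∀ (q : M) (v u : TangentSpace 𝓘(ℝ, E) q), u ≠ 0 → 0 < fiberHess L q v u u
  superlinear : ∀ q : M, Filter.Tendsto (fun v : TangentSpace 𝓘(ℝ, E) q => L ⟨q, v⟩ / ‖v‖)
    (Bornology.cobounded (TangentSpace 𝓘(ℝ, E) q)) Filter.atTop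

/-- Quadratic growth at infinity. -/
def HasQuadraticGrowth (L : TangentBundle 𝓘(ℝ, E) M → ℝ) : Prop :=
  ∃ a > 0, ∃ b A B : ℝ, ∀ (q : M) (v : TangentSpace 𝓘(ℝ, E) q),
    a * ‖v‖ ^ 2 - b ≤ L ⟨q, v⟩ ∧ L ⟨q, v⟩ ≤ A * ‖v‖ ^ 2 + B

/-- The energy `E(q, v) = d_v L(q, v) · v - L(q, v)`. -/
def energy (L : TangentBundle 𝓘(ℝ, E) M → ℝ) (q : M) (v : TangentSpace 𝓘(ℝ, E) q) : ℝ :=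
  fiberDeriv L q v v - L ⟨q, v⟩

/-- `e₀(L) = max_q E(q, 0)`. -/
def maxRestEnergy (L : TangentBundle 𝓘(ℝ, E) M → ℝ) : ℝ :=
  ⨆ q : M, energy L q 0

/-- `‖θ‖_∞` for the one-form `θ_q = d_v L(q, 0)`, with the dual norm on `T_q^* M`. -/
def magneticNorm (L : TangentBundle 𝓘(ℝ, E) M → ℝ) : ℝ :=
  ⨆ q : M, ‖fiberDeriv L q 0‖

/-- Mechanical Lagrangians `L(q, v) = |v|² / 2 - V(q)`. -/
def IsMechanical (L : TangentBundle 𝓘(ℝ, E) M → ℝ) : Prop :=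
  ∃ V : M → ℝ, ContMDiff 𝓘(ℝ, E) 𝓘(ℝ, ℝ) ∞ V ∧
    ∀ (q : M) (v : TangentSpace 𝓘(ℝ, E) q), L ⟨q, v⟩ = 1 / 2 * ‖v‖ ^ 2 - V q

end Tonelli

/-- Closed subsets that are embedded smooth submanifolds (given locally by slices). -/
def IsClosedSubmanifold (E : Type*) [NormedAddCommGroup E] [NormedSpace ℝ E]
    {M : Type*} [TopologicalSpace M] [ChartedSpace E M] (Q : Set M) : Prop :=
  IsClosed Q ∧ ∀ q ∈ Q, ∃ e ∈ IsManifold.maximalAtlas 𝓘(ℝ, E) ∞ M, ∃ V : Submodule ℝ E,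
    q ∈ e.source ∧ ∀ y ∈ e.source, y ∈ Q ↔ e y - e q ∈ V

end ManeChain

end

/-! Every inequality compares two sets of admissible `k`: the larger the set, the smaller its
infimum. A constant loop at `q` has action `T (k - E(q,0))`, which gives `e₀ ≤ c_u`. Projection from
a covering preserves both the class `H¹` and the action (`Cover.isH1_map_proj_iff`,
`action_liftLagrangian`). Contractible loops lift to closed loops, so `c_u ≤ c(L₁)`; loops upstairs
project to loops, so `c(L₁) ≤ c(L)`. Both hold for every subgroup of `π₁(M)`, not only for the one
defined by `Q₀` and `Q₁`. For `c(L) ≤ k₀(L)`, suppose that some loop has negative action. Go from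
`Q₀` to the loop, run around it many times and go on to `Q₁`: the total action is eventually
negative (`action_loop_nonneg`). This rests on additivity of the action under concatenation
(`HasAction.trans`) and on connecting any two points by paths of finite action (`exists_hasAction`).
For the upper bound, Taylor expansion along the fibre gives `L(q,v) ≥ L(q,0) + θ_q(v) + a|v|² ≥ -e₀
- ‖θ‖|v| + a|v|²`, and completing the square makes the integrand nonnegative for `k = e₀ +
‖θ‖²/(4a)`. If `θ = 0`, the two ends of the chain coincide. -/

namespace ManeChain

/-! ### Sobolev functions on an interval: restriction, rescaling, gluing -/

section Sobolev

variable {E : Type*} [NormedAddCommGroup E] [NormedSpace ℝ E]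

/-- Interval integrability of `g` and `‖g‖²` behaves better than `MemLp` under affine substitution
and gluing. -/
theorem isH1On_iff {f : ℝ → E} {a b : ℝ} (hab : a ≤ b) :
    IsH1On f a b ↔ ∃ g : ℝ → E, IntervalIntegrable g volume a b ∧
      IntervalIntegrable (fun s => ‖g s‖ ^ 2) volume a b ∧
      ∀ t ∈ Icc a b, f t = f a + ∫ s in a..t, g s := by
  refine exists_congr fun g => ?_
  rw [← and_assoc]
  refine and_congr_left fun _ => ?_
  rw [intervalIntegrable_iff_integrableOn_Icc_of_le hab,
    intervalIntegrable_iff_integrableOn_Icc_of_le hab]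
  constructor
  · intro h
    have h1 : IntegrableOn g (Icc a b) := h.integrable one_le_two
    exact ⟨h1, (memLp_two_iff_integrable_sq_norm h1.aestronglyMeasurable).1 h⟩
  · rintro ⟨h1, h2⟩
    exact (memLp_two_iff_integrable_sq_norm h1.aestronglyMeasurable).2 h2

theorem IsH1On.mono {f : ℝ → E} {a b a' b' : ℝ} (h : IsH1On f a b) (ha : a ≤ a') (hab : a' ≤ b')
    (hb : b' ≤ b) : IsH1On f a' b' := by
  rw [isH1On_iff (by linarith)] at h
  rw [isH1On_iff hab]
  obtain ⟨g, h1, h2, h3⟩ := h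
  have hs : uIcc a' b' ⊆ uIcc a b := by
    rw [uIcc_of_le hab, uIcc_of_le (by linarith)]
    exact Icc_subset_Icc ha hb
  refine ⟨g, h1.mono_set hs, h2.mono_set hs, fun t ht => ?_⟩
  have i1 : IntervalIntegrable g volume a t := h1.mono_set (by
    rw [uIcc_of_le (by linarith [ht.1]), uIcc_of_le (by linarith)]
    exact Icc_subset_Icc le_rfl (by linarith [ht.2]))
  have i2 : IntervalIntegrable g volume a a' := h1.mono_set (by
    rw [uIcc_of_le ha, uIcc_of_le (by linarith)]
    exact Icc_subset_Icc le_rfl (by linarith))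
  rw [h3 t ⟨by linarith [ht.1], by linarith [ht.2]⟩, h3 a' ⟨ha, by linarith⟩,
    ← intervalIntegral.integral_interval_sub_left i1 i2]
  abel

theorem IsH1On.congr {f f' : ℝ → E} {a b : ℝ} (h : IsH1On f a b) (hf : EqOn f f' (Icc a b)) :
    IsH1On f' a b := by
  obtain ⟨g, hg, h⟩ := h
  refine ⟨g, hg, fun t ht => ?_⟩
  rw [← hf ht, ← hf ⟨le_rfl, ht.1.trans ht.2⟩, h t ht]

theorem _root_.IntervalIntegrable.comp_affine {F : Type*} [NormedAddCommGroup F] {g : ℝ → F}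
    {a b c d : ℝ} (hc : c ≠ 0) (h : IntervalIntegrable g volume (c * a + d) (c * b + d)) :
    IntervalIntegrable (fun s => g (c * s + d)) volume a b := by
  have h1 := (h.comp_add_right d).comp_mul_left (c := c)
  simpa [hc] using h1

theorem IsH1On.comp_affine {f : ℝ → E} {a b c d : ℝ} (hc : 0 < c) (hab : a ≤ b)
    (h : IsH1On f (c * a + d) (c * b + d)) : IsH1On (fun s => f (c * s + d)) a b := by
  rw [isH1On_iff (by nlinarith)] at h
  rw [isH1On_iff hab]
  obtain ⟨g, h1, h2, h3⟩ := h
  refine ⟨fun s => c • g (c * s + d), (h1.comp_affine hc.ne').smul c, ?_, fun t ht => ?_⟩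
  · simp_rw [norm_smul, mul_pow]
    exact (h2.comp_affine hc.ne').const_mul _
  · rw [intervalIntegral.integral_smul, intervalIntegral.integral_comp_mul_add _ hc.ne',
      smul_inv_smul₀ hc.ne']
    exact h3 _ ⟨by nlinarith [ht.1], by nlinarith [ht.2]⟩

theorem _root_.IntervalIntegrable.ite_le {F : Type*} [NormedAddCommGroup F] {g g' : ℝ → F}
    {a b c : ℝ} (hab : a ≤ b) (hbc : b ≤ c) (h : IntervalIntegrable g volume a b)
    (h' : IntervalIntegrable g' volume b c) :
    IntervalIntegrable (fun s => if s ≤ b then g s else g' s) volume a c := by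
  refine IntervalIntegrable.trans (b := b) (h.congr fun s hs => ?_) (h'.congr fun s hs => ?_)
  · rw [uIoc_of_le hab] at hs
    simp [hs.2]
  · rw [uIoc_of_le hbc] at hs
    simp [hs.1]

/-- The glued weak derivative works because the values agree at `b`, so that no jump occurs there.
-/
theorem IsH1On.ite_le {f f' : ℝ → E} {a b c : ℝ} (hab : a ≤ b) (hbc : b ≤ c) (h : IsH1On f a b)
    (h' : IsH1On f' b c) (hf : f b = f' b) :
    IsH1On (fun s => if s ≤ b then f s else f' s) a c := by
  rw [isH1On_iff hab] at h
  rw [isH1On_iff hbc] at h'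
  rw [isH1On_iff (hab.trans hbc)]
  obtain ⟨g, h1, h2, h3⟩ := h
  obtain ⟨g', h1', h2', h3'⟩ := h'
  have hl : ∀ t ∈ Icc a b, ∫ s in a..t, (if s ≤ b then g s else g' s) = ∫ s in a..t, g s := by
    intro t ht
    refine intervalIntegral.integral_congr fun s hs => ?_
    rw [uIcc_of_le ht.1] at hs
    simp [hs.2.trans ht.2]
  refine ⟨fun s => if s ≤ b then g s else g' s, h1.ite_le hab hbc h1', ?_, fun t ht => ?_⟩
  · simp_rw [apply_ite (fun x => ‖x‖ ^ 2)]
    exact h2.ite_le hab hbc h2'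
  · simp only [hab, if_true]
    by_cases htb : t ≤ b
    · rw [if_pos htb, hl t ⟨ht.1, htb⟩]
      exact h3 t ⟨ht.1, htb⟩
    · push Not at htb
      have i : IntervalIntegrable (fun s => if s ≤ b then g s else g' s) volume a t :=
        h1.ite_le hab htb.le (h1'.mono_set (by
          rw [uIcc_of_le htb.le, uIcc_of_le hbc]
          exact Icc_subset_Icc le_rfl ht.2))
      rw [if_neg htb.not_ge, ← intervalIntegral.integral_add_adjacent_intervals
        (b := b) (i.mono_set ?_) (i.mono_set ?_), hl b ⟨hab, le_rfl⟩, ← add_assoc,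
        ← h3 b ⟨hab, le_rfl⟩, hf, h3' t ⟨htb.le, ht.2⟩]
      · congr 1
        refine intervalIntegral.integral_congr_ae (.of_forall fun s hs => ?_)
        rw [uIoc_of_le htb.le] at hs
        simp [hs.1]
      · rw [uIcc_of_le hab, uIcc_of_le ht.1]
        exact Icc_subset_Icc le_rfl htb.le
      · rw [uIcc_of_le htb.le, uIcc_of_le ht.1]
        exact Icc_subset_Icc hab le_rfl

theorem isH1On_of_hasDerivAt [CompleteSpace E] {f f' : ℝ → E} {a b : ℝ} (hab : a ≤ b)
    (hf : ∀ t ∈ Icc a b, HasDerivAt f (f' t) t) (hf' : ContinuousOn f' (Icc a b)) :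
    IsH1On f a b := by
  rw [isH1On_iff hab]
  rw [← uIcc_of_le hab] at hf'
  refine ⟨f', hf'.intervalIntegrable, (hf'.norm.pow 2).intervalIntegrable, fun t ht => ?_⟩
  have hs : uIcc a t ⊆ uIcc a b := by
    rw [uIcc_of_le ht.1, uIcc_of_le hab]
    exact Icc_subset_Icc le_rfl ht.2
  rw [intervalIntegral.integral_eq_sub_of_hasDerivAt (f := f)
    (fun s hs' => hf s (by simpa [uIcc_of_le hab] using hs hs')) (hf'.mono hs).intervalIntegrable]
  abel

end Sobolev

/-! ### Curves of class `H¹`, their velocities, and concatenation -/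

section Curves

variable {E : Type*} [NormedAddCommGroup E] [NormedSpace ℝ E]
  {N : Type*} [TopologicalSpace N] [ChartedSpace E N]

/-- The curve `c` is of class `H¹` near the time `t`. -/
def IsH1At (E : Type*) [NormedAddCommGroup E] [NormedSpace ℝ E] {N : Type*} [TopologicalSpace N]
    [ChartedSpace E N] (c : ℝ → N) (t : ℝ) : Prop :=
  ∃ ε > 0, MapsTo c (Icc (t - ε) (t + ε)) (chartAt E (c t)).source ∧
    IsH1On (fun s => chartAt E (c t) (c s)) (t - ε) (t + ε)

theorem isH1_iff {q q' : N} {γ : Path q q'} :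
    IsH1 (E := E) γ ↔ ∀ t ∈ Icc (0 : ℝ) 1, IsH1At E γ.extend t := Iff.rfl

theorem IsH1At.exists_forall_le {c : ℝ → N} {t : ℝ} (h : IsH1At E c t) : ∃ ε > 0, ∀ δ > 0, δ ≤ ε →
    MapsTo c (Icc (t - δ) (t + δ)) (chartAt E (c t)).source ∧
    IsH1On (fun s => chartAt E (c t) (c s)) (t - δ) (t + δ) := by
  obtain ⟨ε, hε, h1, h2⟩ := h
  exact ⟨ε, hε, fun δ hδ hδε => ⟨h1.mono_left (Icc_subset_Icc (by linarith) (by linarith)),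
    h2.mono (by linarith) (by linarith) (by linarith)⟩⟩

theorem IsH1At.congr {c c' : ℝ → N} {t : ℝ} (h : IsH1At E c t) (hc : c =ᶠ[𝓝 t] c') :
    IsH1At E c' t := by
  obtain ⟨ε, hε, h⟩ := h.exists_forall_le
  obtain ⟨r, hr, hrc⟩ := Metric.eventually_nhds_iff.1 hc
  -- Half of `r`, so that the closed interval lies in the open ball where the curves agree.
  have hδ : 0 < min ε (r / 2) := by positivity
  obtain ⟨h1, h2⟩ := h _ hδ (min_le_left _ _)
  have he : EqOn c c' (Icc (t - min ε (r / 2)) (t + min ε (r / 2))) := fun s hs => hrc (by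
    rw [Real.dist_eq, abs_lt]
    constructor <;> linarith [hs.1, hs.2, min_le_right ε (r / 2)])
  refine ⟨_, hδ, ?_, ?_⟩
  · rw [← hc.eq_of_nhds]
    exact h1.congr he
  · rw [← hc.eq_of_nhds]
    exact h2.congr fun s hs => congrArg _ (he hs)

theorem IsH1At.comp_affine {c : ℝ → N} {k d t : ℝ} (hk : 0 < k) (h : IsH1At E c (k * t + d)) :
    IsH1At E (fun s => c (k * s + d)) t := by
  obtain ⟨ε, hε, h1, h2⟩ := h
  have e1 : k * (t - ε / k) + d = k * t + d - ε := by field_simp; ring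
  have e2 : k * (t + ε / k) + d = k * t + d + ε := by field_simp; ring
  have hεk : 0 < ε / k := by positivity
  refine ⟨ε / k, hεk, fun s hs => h1 ⟨?_, ?_⟩, ?_⟩
  · rw [← e1]; nlinarith [hs.1]
  · rw [← e2]; nlinarith [hs.2]
  · refine IsH1On.comp_affine (f := fun s => chartAt E (c (k * t + d)) (c s)) hk (by linarith) ?_
    rwa [e1, e2]

/-- Both curves are assumed `H¹` on both sides of `t`; paths extended by constants satisfy this even
at their endpoints. -/
theorem IsH1At.ite_le {c c' : ℝ → N} {t : ℝ} (h : IsH1At E c t) (h' : IsH1At E c' t)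
    (hc : c t = c' t) : IsH1At E (fun s => if s ≤ t then c s else c' s) t := by
  obtain ⟨ε, hε, h⟩ := h.exists_forall_le
  obtain ⟨ε', hε', h'⟩ := h'.exists_forall_le
  have hδ : 0 < min ε ε' := lt_min hε hε'
  obtain ⟨h1, h2⟩ := h _ hδ (min_le_left _ _)
  obtain ⟨h1', h2'⟩ := h' _ hδ (min_le_right _ _)
  rw [← hc] at h1' h2'
  refine ⟨_, hδ, ?_, ?_⟩
  · intro s hs
    simp only [le_refl, if_true]
    split_ifs
    · exact h1 hs
    · exact h1' hs
  · simp only [le_refl, if_true, apply_ite (chartAt E (c t))]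
    exact (h2.mono le_rfl (by linarith) (by linarith)).ite_le (by linarith) (by linarith)
      (h2'.mono (by linarith) (by linarith) le_rfl) (congrArg _ hc)

/-- The derivative of the curve `c` at `s` applied to `x`, as a point of the tangent bundle. -/
noncomputable def scaledVelocity (c : ℝ → N) (s x : ℝ) : TangentBundle 𝓘(ℝ, E) N :=
  tangentMap 𝓘(ℝ, ℝ) 𝓘(ℝ, E) c ⟨s, x⟩

theorem scaledVelocity_congr {c c' : ℝ → N} {s : ℝ} (h : c =ᶠ[𝓝 s] c') (x : ℝ) :
    scaledVelocity (E := E) c s x = scaledVelocity c' s x := by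
  have h1 : (mfderiv 𝓘(ℝ, ℝ) 𝓘(ℝ, E) c s : ℝ →L[ℝ] E) = mfderiv 𝓘(ℝ, ℝ) 𝓘(ℝ, E) c' s :=
    h.mfderiv_eq
  exact Bundle.TotalSpace.ext h.eq_of_nhds
    (heq_of_eq (congrArg (fun l : ℝ →L[ℝ] E => l x) h1))

/-- The equivalence is needed in both directions: where one curve is not differentiable, neither is
the other, and both derivatives take the default value zero. -/
theorem mdifferentiableAt_comp_affine_iff {c : ℝ → N} {k d s : ℝ} (hk : k ≠ 0) :
    MDifferentiableAt 𝓘(ℝ, ℝ) 𝓘(ℝ, E) (fun s => c (k * s + d)) s ↔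
      MDifferentiableAt 𝓘(ℝ, ℝ) 𝓘(ℝ, E) c (k * s + d) := by
  constructor
  · intro h
    have e : k⁻¹ * (k * s + d) - k⁻¹ * d = s := by field_simp; ring
    have h' : MDifferentiableAt 𝓘(ℝ, ℝ) 𝓘(ℝ, ℝ) (fun u : ℝ => k⁻¹ * u - k⁻¹ * d) (k * s + d) :=
      DifferentiableAt.mdifferentiableAt (by fun_prop)
    have := MDifferentiableAt.comp (I' := 𝓘(ℝ, ℝ)) (I'' := 𝓘(ℝ, E)) (k * s + d)
      (g := fun s => c (k * s + d)) (by rwa [e]) h'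
    refine this.congr_of_eventuallyEq (.of_forall fun u => ?_)
    simp only [Function.comp]
    congr 1
    field_simp
    ring
  · intro h
    have h' : MDifferentiableAt 𝓘(ℝ, ℝ) 𝓘(ℝ, ℝ) (fun u : ℝ => k * u + d) s :=
      DifferentiableAt.mdifferentiableAt (by fun_prop)
    exact MDifferentiableAt.comp (I' := 𝓘(ℝ, ℝ)) (I'' := 𝓘(ℝ, E)) s (g := c) h h'

theorem scaledVelocity_comp_affine {c : ℝ → N} {k d s : ℝ} (hk : k ≠ 0) (x : ℝ) :
    scaledVelocity (E := E) (fun s => c (k * s + d)) s x = scaledVelocity c (k * s + d) (k * x) := by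
  refine congrArg (Bundle.TotalSpace.mk (c (k * s + d))) ?_
  by_cases h : MDifferentiableAt 𝓘(ℝ, ℝ) 𝓘(ℝ, E) c (k * s + d)
  · have h' : HasDerivAt (fun u : ℝ => k * u + d) k s := by
      simpa using ((hasDerivAt_id s).const_mul k).add_const d
    have h2 := h.hasMFDerivAt.comp s h'.hasFDerivAt.hasMFDerivAt
    have h3 := h2.mfderiv
    change mfderiv 𝓘(ℝ, ℝ) 𝓘(ℝ, E) (c ∘ fun u => k * u + d) s x = _
    rw [h3]
    change (mfderiv 𝓘(ℝ, ℝ) 𝓘(ℝ, E) c (k * s + d)) (x * k : ℝ)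
      = (mfderiv 𝓘(ℝ, ℝ) 𝓘(ℝ, E) c (k * s + d)) (k * x : ℝ)
    rw [mul_comm x k]
  · change mfderiv 𝓘(ℝ, ℝ) 𝓘(ℝ, E) (fun s => c (k * s + d)) s x
      = mfderiv 𝓘(ℝ, ℝ) 𝓘(ℝ, E) c (k * s + d) (k * x : ℝ)
    rw [mfderiv_zero_of_not_mdifferentiableAt h, mfderiv_zero_of_not_mdifferentiableAt
      (mt (mdifferentiableAt_comp_affine_iff hk).1 h)]
    rfl

theorem action_eq (L : TangentBundle 𝓘(ℝ, E) N → ℝ) (k : ℝ) {q q' : N} (γ : Path q q') (T : ℝ) :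
    action L k γ T
      = T * ∫ s in (0 : ℝ)..1, (L (scaledVelocity γ.extend s T⁻¹) + k) := by
  unfold action velocity
  congr 2
  ext s
  congr 3
  have h : ∀ l : ℝ →L[ℝ] E, T⁻¹ • l 1 = l T⁻¹ := fun l => by
    rw [← map_smul, smul_eq_mul, mul_one]
  exact h _

/-- Concatenation of two paths, where the first one is run through during `[0, τ]`. -/
noncomputable def concat {p q r : N} (γ : Path p q) (γ' : Path q r) (τ : ℝ) (h0 : 0 < τ)
    (h1 : τ < 1) : Path p r where
  toFun s := if (s : ℝ) ≤ τ then γ.extend (τ⁻¹ * s + 0)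
    else γ'.extend ((1 - τ)⁻¹ * s + -τ * (1 - τ)⁻¹)
  continuous_toFun := by
    refine Continuous.if_le ?_ ?_ continuous_subtype_val continuous_const ?_
    · exact γ.continuous_extend.comp (by fun_prop)
    · exact γ'.continuous_extend.comp (by fun_prop)
    · intro s hs
      have e1 : τ⁻¹ * (s : ℝ) + 0 = 1 := by rw [hs, add_zero, inv_mul_cancel₀ h0.ne']
      have e2 : (1 - τ)⁻¹ * (s : ℝ) + -τ * (1 - τ)⁻¹ = 0 := by rw [hs]; ring
      rw [e1, e2, γ.extend_one, γ'.extend_zero]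
  source' := by simp [h0.le]
  target' := by
    have : 1 - τ ≠ 0 := by linarith
    have e2 : (1 - τ)⁻¹ * (1 : ℝ) + -τ * (1 - τ)⁻¹ = 1 := by field_simp; ring
    simp only [Icc.coe_one, h1.not_ge, if_false]
    rw [e2, γ'.extend_one]

/-- The formula holds on all of `ℝ`: the affine reparametrizations send `s ≤ 0` to nonpositive times
and `s ≥ 1` to times beyond `1`, where the extensions are constant. -/
theorem concat_extend {p q r : N} (γ : Path p q) (γ' : Path q r) {τ : ℝ} (h0 : 0 < τ)
    (h1 : τ < 1) : (concat γ γ' τ h0 h1).extend = fun s => if s ≤ τ then γ.extend (τ⁻¹ * s + 0)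
      else γ'.extend ((1 - τ)⁻¹ * s + -τ * (1 - τ)⁻¹) := by
  have h1' : 0 < 1 - τ := by linarith
  ext s
  rcases le_total s 0 with hs | hs
  · rw [Path.extend_of_le_zero _ hs, if_pos (hs.trans h0.le), Path.extend_of_le_zero]
    rw [add_zero]
    exact mul_nonpos_of_nonneg_of_nonpos (by positivity) hs
  rcases le_total 1 s with hs' | hs'
  · rw [Path.extend_of_one_le _ hs', if_neg (by linarith), Path.extend_of_one_le]
    have : (1 - τ)⁻¹ * s + -τ * (1 - τ)⁻¹ = (s - τ) / (1 - τ) := by ring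
    rw [this, one_le_div h1']
    linarith
  · rw [Path.extend_apply _ ⟨hs, hs'⟩]
    rfl

theorem concat_extend_of_lt {p q r : N} (γ : Path p q) (γ' : Path q r) {τ : ℝ} (h0 : 0 < τ)
    (h1 : τ < 1) {s : ℝ} (hs : s < τ) :
    (concat γ γ' τ h0 h1).extend =ᶠ[𝓝 s] fun s => γ.extend (τ⁻¹ * s + 0) := by
  filter_upwards [Iio_mem_nhds hs] with u hu
  rw [concat_extend]
  exact if_pos (le_of_lt hu)

theorem concat_extend_of_gt {p q r : N} (γ : Path p q) (γ' : Path q r) {τ : ℝ} (h0 : 0 < τ)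
    (h1 : τ < 1) {s : ℝ} (hs : τ < s) : (concat γ γ' τ h0 h1).extend =ᶠ[𝓝 s]
      fun s => γ'.extend ((1 - τ)⁻¹ * s + -τ * (1 - τ)⁻¹) := by
  filter_upwards [Ioi_mem_nhds hs] with u hu
  rw [concat_extend]
  exact if_neg (not_le_of_gt hu)

theorem IsH1.concat {p q r : N} {γ : Path p q} {γ' : Path q r} {τ : ℝ} {h0 : 0 < τ} {h1 : τ < 1}
    (h : IsH1 (E := E) γ) (h' : IsH1 (E := E) γ') : IsH1 (E := E) (concat γ γ' τ h0 h1) := by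
  rw [isH1_iff] at *
  have h1' : 0 < 1 - τ := by linarith
  have hl : ∀ t ∈ Icc 0 τ, IsH1At E (fun s => γ.extend (τ⁻¹ * s + 0)) t := fun t ht => by
    refine (h _ ⟨?_, ?_⟩).comp_affine (by positivity)
    · have := ht.1
      positivity
    · rw [add_zero, inv_mul_le_one₀ h0]
      exact ht.2
  have hr : ∀ t ∈ Icc τ 1,
      IsH1At E (fun s => γ'.extend ((1 - τ)⁻¹ * s + -τ * (1 - τ)⁻¹)) t := fun t ht => by
    have : (1 - τ)⁻¹ * t + -τ * (1 - τ)⁻¹ = (t - τ) / (1 - τ) := by ring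
    refine (h' _ ?_).comp_affine (by positivity)
    rw [this]
    exact ⟨div_nonneg (by linarith [ht.1]) h1'.le, (div_le_one h1').2 (by linarith [ht.2])⟩
  intro t ht
  rcases lt_trichotomy t τ with hlt | rfl | hgt
  · exact (hl t ⟨ht.1, hlt.le⟩).congr (concat_extend_of_lt γ γ' h0 h1 hlt).symm
  · rw [concat_extend]
    refine (hl t ⟨ht.1, le_rfl⟩).ite_le (hr t ⟨le_rfl, ht.2⟩) ?_
    have e1 : t⁻¹ * t + 0 = 1 := by rw [add_zero, inv_mul_cancel₀ h0.ne']
    have e2 : (1 - t)⁻¹ * t + -t * (1 - t)⁻¹ = 0 := by ring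
    rw [e1, e2, γ.extend_one, γ'.extend_zero]
  · exact (hr t ⟨hgt.le, ht.2⟩).congr (concat_extend_of_gt γ γ' h0 h1 hgt).symm

/-- There is an `H¹`-path from `p` to `q` with integrable Lagrangian that is run through in time `T`
with action `A`. -/
def HasAction (L : TangentBundle 𝓘(ℝ, E) N → ℝ) (k : ℝ) (p q : N) (T A : ℝ) : Prop :=
  0 < T ∧ ∃ γ : Path p q, IsH1 (E := E) γ ∧
    IntervalIntegrable (fun s => L (scaledVelocity γ.extend s T⁻¹) + k)
      volume 0 1 ∧ action L k γ T = A

/-- Integrability is part of `HasAction` because the integral over `[0,1]` can be split only for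
integrable functions. -/
theorem HasAction.trans {L : TangentBundle 𝓘(ℝ, E) N → ℝ} {k : ℝ} {p q r : N} {T A T' A' : ℝ}
    (h : HasAction L k p q T A) (h' : HasAction L k q r T' A') :
    HasAction L k p r (T + T') (A + A') := by
  obtain ⟨hT, γ, hγ, hi, rfl⟩ := h
  obtain ⟨hT', γ', hγ', hi', rfl⟩ := h'
  have hTT : 0 < T + T' := by linarith
  -- With this switching time each half, run in total time `T + T'`, keeps its original physical
  -- speed.
  set τ := T / (T + T') with hτ
  have h0 : 0 < τ := by positivity
  have h1 : τ < 1 := by rw [hτ, div_lt_one hTT]; linarith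
  have h1' : 0 < 1 - τ := by linarith
  have eT : τ⁻¹ * (T + T')⁻¹ = T⁻¹ := by rw [hτ]; field_simp
  have eT' : (1 - τ)⁻¹ * (T + T')⁻¹ = T'⁻¹ := by
    have : 1 - τ = T' / (T + T') := by rw [hτ]; field_simp; ring
    rw [this]; field_simp
  set F := fun s => L (scaledVelocity γ.extend s T⁻¹) + k with hF
  set F' := fun s => L (scaledVelocity γ'.extend s T'⁻¹) + k with hF'
  set c := concat γ γ' τ h0 h1 with hc
  set H := fun s => L (scaledVelocity c.extend s (T + T')⁻¹) + k with hH
  have hl : ∀ s < τ, H s = F (τ⁻¹ * s + 0) := by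
    intro s hs
    rw [hH, hF]
    dsimp only
    rw [scaledVelocity_congr (concat_extend_of_lt γ γ' h0 h1 hs),
      scaledVelocity_comp_affine (inv_ne_zero h0.ne'), eT]
  have hr : ∀ s > τ, H s = F' ((1 - τ)⁻¹ * s + -τ * (1 - τ)⁻¹) := by
    intro s hs
    rw [hH, hF']
    dsimp only
    rw [scaledVelocity_congr (concat_extend_of_gt γ γ' h0 h1 hs),
      scaledVelocity_comp_affine (inv_ne_zero h1'.ne'), eT']
  -- At the switching time itself the velocity may be anything; a single point is a null set.
  have hne : ∀ᵐ s : ℝ, s ≠ τ := by simp [ae_iff]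
  have hl' : ∀ᵐ s : ℝ, s ∈ Set.uIoc 0 τ → H s = F (τ⁻¹ * s + 0) := by
    filter_upwards [hne] with s hs hs'
    rw [uIoc_of_le h0.le] at hs'
    exact hl s (lt_of_le_of_ne hs'.2 hs)
  have hr' : ∀ᵐ s : ℝ, s ∈ Set.uIoc τ 1 → H s = F' ((1 - τ)⁻¹ * s + -τ * (1 - τ)⁻¹) := by
    refine .of_forall fun s hs' => ?_
    rw [uIoc_of_le h1.le] at hs'
    exact hr s hs'.1
  have el0 : τ⁻¹ * 0 + 0 = (0 : ℝ) := by ring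
  have el1 : τ⁻¹ * τ + 0 = (1 : ℝ) := by rw [add_zero, inv_mul_cancel₀ h0.ne']
  have er0 : (1 - τ)⁻¹ * τ + -τ * (1 - τ)⁻¹ = 0 := by ring
  have er1 : (1 - τ)⁻¹ * 1 + -τ * (1 - τ)⁻¹ = 1 := by
    rw [show (1 - τ)⁻¹ * 1 + -τ * (1 - τ)⁻¹ = (1 - τ)⁻¹ * (1 - τ) by ring,
      inv_mul_cancel₀ h1'.ne']
  have il : IntervalIntegrable H volume 0 τ := by
    refine (IntervalIntegrable.comp_affine (inv_ne_zero h0.ne')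
      (by rw [el0, el1]; exact hi)).congr_ae ?_
    rw [Filter.EventuallyEq, ae_restrict_iff' measurableSet_uIoc]
    filter_upwards [hl'] with s hs hs'
    exact (hs hs').symm
  have ir : IntervalIntegrable H volume τ 1 := by
    refine (IntervalIntegrable.comp_affine (inv_ne_zero h1'.ne')
      (by rw [er0, er1]; exact hi')).congr_ae ?_
    rw [Filter.EventuallyEq, ae_restrict_iff' measurableSet_uIoc]
    filter_upwards [hr'] with s hs hs'
    exact (hs hs').symm
  refine ⟨hTT, c, hγ.concat hγ', il.trans ir, ?_⟩
  rw [action_eq, action_eq, action_eq, ← intervalIntegral.integral_add_adjacent_intervals il ir,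
    intervalIntegral.integral_congr_ae hl', intervalIntegral.integral_congr_ae hr',
    intervalIntegral.integral_comp_mul_add F (inv_ne_zero h0.ne'),
    intervalIntegral.integral_comp_mul_add F' (inv_ne_zero h1'.ne'), el0, el1, er0, er1,
    inv_inv, inv_inv, smul_eq_mul, smul_eq_mul, mul_add, ← mul_assoc, ← mul_assoc]
  congr 2
  · rw [hτ]; field_simp
  · rw [hτ]; field_simp; ring

/-- The count is `n + 1`, since zero turns would take time zero, which `HasAction` excludes. -/
theorem HasAction.iterate {L : TangentBundle 𝓘(ℝ, E) N → ℝ} {k : ℝ} {p : N} {T A : ℝ}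
    (h : HasAction L k p p T A) (n : ℕ) : HasAction L k p p ((n + 1) * T) ((n + 1) * A) := by
  induction n with
  | zero => simpa using h
  | succ n ih =>
    have := ih.trans h
    push_cast
    convert this using 1 <;> ring

/-- A non-integrable integrand has integral zero by convention, so a negative action forces
integrability. -/
theorem HasAction.of_action_neg {L : TangentBundle 𝓘(ℝ, E) N → ℝ} {k : ℝ} {p q : N} {T : ℝ}
    (hT : 0 < T) {γ : Path p q} (hγ : IsH1 (E := E) γ) (h : action L k γ T < 0) :
    HasAction L k p q T (action L k γ T) := by
  refine ⟨hT, γ, hγ, ?_, rfl⟩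
  by_contra hi
  rw [action_eq, intervalIntegral.integral_undef hi, mul_zero] at h
  exact h.false

end Curves

/-! ### Connecting points by smooth paths, and `c(L) ≤ k₀(L)` -/

section Connect

variable {E : Type*} [NormedAddCommGroup E] [NormedSpace ℝ E]
  {N : Type*} [TopologicalSpace N] [ChartedSpace E N] [IsManifold 𝓘(ℝ, E) ∞ N]

theorem isH1At_of_contMDiff [CompleteSpace E] {c : ℝ → N} (hc : ContMDiff 𝓘(ℝ, ℝ) 𝓘(ℝ, E) ∞ c)
    (t : ℝ) : IsH1At E c t := by
  set φ := chartAt E (c t)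
  have ho : IsOpen (c ⁻¹' φ.source) := φ.open_source.preimage hc.continuous
  have hφ : ContDiffOn ℝ ∞ (fun s => φ (c s)) (c ⁻¹' φ.source) :=
    ((contMDiffOn_chart (n := ∞) (x := c t)).comp hc.contMDiffOn
      fun s hs => hs).contDiffOn
  obtain ⟨ε, hε, hb⟩ := Metric.nhds_basis_closedBall.mem_iff.1
    (ho.mem_nhds (mem_chart_source E (c t)))
  rw [Real.closedBall_eq_Icc] at hb
  refine ⟨ε, hε, hb, isH1On_of_hasDerivAt (by linarith) (fun s hs => ?_)
    ((hφ.continuousOn_deriv_of_isOpen ho (by simp)).mono hb)⟩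
  exact ((hφ.differentiableOn (by simp)).differentiableAt (ho.mem_nhds (hb hs))).hasDerivAt

theorem continuous_scaledVelocity {c : ℝ → N} (hc : ContMDiff 𝓘(ℝ, ℝ) 𝓘(ℝ, E) ∞ c) (x : ℝ) :
    Continuous fun s => scaledVelocity (E := E) c s x := by
  have h : Continuous fun s : ℝ => (⟨s, x⟩ : TangentBundle 𝓘(ℝ, ℝ) ℝ) :=
    (tangentBundleModelSpaceHomeomorph 𝓘(ℝ, ℝ)).symm.continuous.comp
      (continuous_id.prodMk continuous_const)
  exact (hc.continuous_tangentMap (by simp)).comp h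

theorem HasAction.of_contMDiff [CompleteSpace E] {L : TangentBundle 𝓘(ℝ, E) N → ℝ}
    (hL : Continuous L) (k : ℝ) {p q : N} {γ : Path p q}
    (hγ : ContMDiff 𝓘(ℝ, ℝ) 𝓘(ℝ, E) ∞ γ.extend) : HasAction L k p q 1 (action L k γ 1) :=
  ⟨one_pos, γ, fun t _ => isH1At_of_contMDiff hγ t,
    ((hL.comp (continuous_scaledVelocity hγ _)).add continuous_const).intervalIntegrable _ _, rfl⟩

theorem exists_contMDiff_path (p : N) : ∃ U ∈ 𝓝 p, ∀ x ∈ U, ∀ y ∈ U, ∃ γ : Path x y,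
    ContMDiff 𝓘(ℝ, ℝ) 𝓘(ℝ, E) ∞ γ.extend := by
  set φ := chartAt E p
  have hp : p ∈ φ.source := mem_chart_source E p
  obtain ⟨r, hr, hball⟩ := Metric.isOpen_iff.1 φ.open_target (φ p) (φ.map_source hp)
  refine ⟨φ.source ∩ φ ⁻¹' Metric.ball (φ p) r,
    (φ.isOpen_inter_preimage Metric.isOpen_ball).mem_nhds ⟨hp, Metric.mem_ball_self hr⟩, ?_⟩
  rintro x ⟨hx, hxb⟩ y ⟨hy, hyb⟩
  -- The smooth transition function is flat at both ends, so the extension by constants is smooth on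
  -- all of `ℝ`.
  set l : ℝ → E := fun s => φ x + Real.smoothTransition s • (φ y - φ x) with hl
  have hlt : ∀ s, l s ∈ φ.target := fun s => hball <|
    (convex_ball (φ p) r).add_smul_sub_mem hxb hyb
      ⟨Real.smoothTransition.nonneg s, Real.smoothTransition.le_one s⟩
  have hls : ContDiff ℝ ∞ l :=
    contDiff_const.add (Real.smoothTransition.contDiff.smul contDiff_const)
  have hc : ContMDiff 𝓘(ℝ, ℝ) 𝓘(ℝ, E) ∞ (fun s => φ.symm (l s)) :=
    (contMDiffOn_chart_symm (n := ∞) (x := p)).comp_contMDiff hls.contMDiff hlt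
  have h0 : ∀ s ≤ 0, φ.symm (l s) = x := fun s hs => by
    simp [hl, Real.smoothTransition.zero_of_nonpos hs, φ.left_inv hx]
  have h1 : ∀ s, 1 ≤ s → φ.symm (l s) = y := fun s hs => by
    simp [hl, Real.smoothTransition.one_of_one_le hs, φ.left_inv hy]
  refine ⟨⟨⟨fun s => φ.symm (l s), hc.continuous.comp continuous_subtype_val⟩, h0 0 le_rfl,
    h1 1 le_rfl⟩, hc.congr fun s => ?_⟩
  rcases le_total s 0 with hs | hs
  · rw [Path.extend_of_le_zero _ hs, h0 s hs]
  rcases le_total 1 s with hs' | hs'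
  · rw [Path.extend_of_one_le _ hs', h1 s hs']
  · rw [Path.extend_apply _ ⟨hs, hs'⟩]
    rfl

/-- Nearby points are joined inside a chart; transitivity and connectedness spread this to all
pairs. -/
theorem exists_hasAction [CompleteSpace E] [PreconnectedSpace N]
    {L : TangentBundle 𝓘(ℝ, E) N → ℝ} (hL : Continuous L) (k : ℝ) (p q : N) :
    ∃ T A, HasAction L k p q T A := by
  refine PreconnectedSpace.induction₂' (fun p q => ∃ T A, HasAction L k p q T A) (fun x => ?_)
    ⟨fun _ _ _ ⟨_, _, h⟩ ⟨_, _, h'⟩ => ⟨_, _, h.trans h'⟩⟩ p q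
  obtain ⟨U, hU, h⟩ := exists_contMDiff_path (E := E) x
  filter_upwards [hU] with y hy
  obtain ⟨γ, hγ⟩ := h x (mem_of_mem_nhds hU) y hy
  obtain ⟨γ', hγ'⟩ := h y hy x (mem_of_mem_nhds hU)
  exact ⟨⟨_, _, .of_contMDiff hL k hγ⟩, ⟨_, _, .of_contMDiff hL k hγ'⟩⟩

theorem action_loop_nonneg [CompleteSpace E] [PreconnectedSpace N]
    {L : TangentBundle 𝓘(ℝ, E) N → ℝ} (hL : Continuous L) {k : ℝ} {p q : N}
    (h : ∀ γ : Path p q, IsH1 (E := E) γ → ∀ T > 0, 0 ≤ action L k γ T) {x : N} {γ : Path x x}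
    (hγ : IsH1 (E := E) γ) {T : ℝ} (hT : 0 < T) : 0 ≤ action L k γ T := by
  by_contra! hneg
  obtain ⟨T₀, A₀, h₀⟩ := exists_hasAction hL k p x
  obtain ⟨T₁, A₁, h₁⟩ := exists_hasAction hL k x q
  have hγ' := HasAction.of_action_neg hT hγ hneg
  -- This `n` makes `A₀ + (n + 1) * action L k γ T + A₁` negative.
  obtain ⟨n, hn⟩ := exists_nat_gt ((A₀ + A₁) / -action L k γ T)
  rw [div_lt_iff₀ (by linarith)] at hn
  obtain ⟨hT', γ', hγ', -, hA⟩ := (h₀.trans (hγ'.iterate n)).trans h₁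
  have := h γ' hγ' _ hT'
  rw [hA] at this
  linarith

theorem criticalValue_le_criticalValuePaths [CompleteSpace E] [PreconnectedSpace N]
    {L : TangentBundle 𝓘(ℝ, E) N → ℝ} (hL : Continuous L) {Q₀ Q₁ : Set N} (h₀ : Q₀.Nonempty)
    (h₁ : Q₁.Nonempty) : criticalValue L ≤ criticalValuePaths L Q₀ Q₁ := by
  obtain ⟨q₀, hq₀⟩ := h₀
  obtain ⟨q₁, hq₁⟩ := h₁
  exact sInf_le_sInf (image_mono fun k hk x γ hγ T hT =>
    action_loop_nonneg hL (hk q₀ hq₀ q₁ hq₁) hγ hT)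

end Connect

/-! ### Lifting paths to the coverings -/

section CoverPaths

variable {M : Type*} [TopologicalSpace M] {m : M} {G : Subgroup (FundamentalGroup M m)}

theorem Cover.move_cast (x : Cover G) {q q' : M} (δ : Path x.proj q) (h : q' = q) :
    x.move (δ.cast rfl h) = x.move δ := by
  subst h
  rfl

/-- Gives continuity of the lift: its value at `t'` arises from the one at `t` by moving along the
piece of `γ` in between, which is short when `t'` is near `t`. -/
theorem Cover.move_move_subpath (x : Cover G) {q : M} (γ : Path x.proj q) (t t' : I) :
    (x.move ((γ.subpath 0 t).cast γ.source.symm rfl)).move (q := γ t') (γ.subpath t t')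
      = x.move ((γ.subpath 0 t').cast γ.source.symm rfl) := by
  rw [Cover.move_trans]
  refine x.move_congr ?_
  have h : ((γ.subpath 0 t).trans (γ.subpath t t')).Homotopic (γ.subpath 0 t') :=
    ⟨Path.Homotopy.subpathTransSubpath γ 0 t t'⟩
  exact h.pathCast γ.source.symm rfl

/-- The lift of a path to the covering, started at a given point. -/
noncomputable def Cover.liftPath (x : Cover G) {q : M} (γ : Path x.proj q) : Path x (x.move γ) where
  toFun t := x.move ((γ.subpath 0 t).cast γ.source.symm rfl)
  continuous_toFun := by
    refine continuous_iff_continuousAt.2 fun t => ?_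
    rw [ContinuousAt, tendsto_nhds]
    intro W hW ht
    obtain ⟨U, hU, htU, h⟩ := hW _ ht
    obtain ⟨ε, hε, hb⟩ := Metric.isOpen_iff.1 (hU.preimage γ.continuous) t htU
    filter_upwards [Metric.ball_mem_nhds t hε] with t' ht'
    rw [mem_preimage, ← x.move_move_subpath γ t t']
    refine h _ _ (show range (γ.subpath t t') ⊆ U from ?_)
    rw [Path.range_subpath]
    rintro _ ⟨s, hs, rfl⟩
    have hd : dist (t : ℝ) s ≤ dist (t : ℝ) t' :=
      Real.dist_left_le_of_mem_uIcc (mem_uIcc.2 (mem_uIcc.1 hs))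
    exact hb (Metric.mem_ball'.2 (hd.trans_lt (Metric.mem_ball'.1 ht')))
  source' := by
    have : (γ.subpath 0 0).cast γ.source.symm rfl = (Path.refl x.proj).cast rfl γ.source := by
      ext
      simp
    rw [this, x.move_cast, x.move_refl]
  target' := by
    have : (γ.subpath 0 1).cast γ.source.symm rfl = γ.cast rfl γ.target := by
      ext
      simp
    rw [this, x.move_cast]

end CoverPaths

/-! ### Smoothness of the projection, invariance of the action, and `c_u(L) ≤ c(L₁) ≤ c(L)` -/

section CoverSmooth

variable {E : Type*} [NormedAddCommGroup E] [NormedSpace ℝ E]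
  {M : Type*} [TopologicalSpace M] [ChartedSpace E M] {m : M}
  {G : Subgroup (FundamentalGroup M m)}

/-- Because of this, a curve and its projection have the same coordinate expression, and regularity
transfers in both directions. -/
theorem Cover.chartAt_apply (x y : Cover G) : chartAt E x y = chartAt E x.proj y.proj := by
  change chartAt E x.proj (Classical.choose (Cover.isLocalHomeomorph E x) y) = _
  rw [← (Classical.choose_spec (Cover.isLocalHomeomorph E x)).2]

theorem Cover.proj_mem_chartAt_source {x y : Cover G} (h : y ∈ (chartAt E x).source) :
    y.proj ∈ (chartAt E x.proj).source := by
  have h' : Classical.choose (Cover.isLocalHomeomorph E x) y ∈ (chartAt E x.proj).source := h.2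
  rwa [← (Classical.choose_spec (Cover.isLocalHomeomorph E x)).2] at h'

theorem Cover.contMDiff_proj : ContMDiff 𝓘(ℝ, E) 𝓘(ℝ, E) ∞ (Cover.proj : Cover G → M) := by
  intro x
  rw [contMDiffAt_iff]
  refine ⟨Cover.continuous_proj.continuousAt, ?_⟩
  refine contDiffWithinAt_id.congr_of_eventuallyEq (f := id) ?_ ?_
  · refine nhdsWithin_le_nhds ?_
    filter_upwards [(chartAt E x).open_target.mem_nhds (mem_chart_target E x)] with z hz
    change chartAt E x.proj ((chartAt E x).symm z).proj = z
    rw [← Cover.chartAt_apply, (chartAt E x).right_inv hz]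
  · change chartAt E x.proj ((chartAt E x).symm (chartAt E x x)).proj = chartAt E x x
    rw [← Cover.chartAt_apply, (chartAt E x).right_inv (mem_chart_target E x)]

theorem Cover.isH1At_proj_iff {c : ℝ → Cover G} (hc : Continuous c) (t : ℝ) :
    IsH1At E (fun s => (c s).proj) t ↔ IsH1At E c t := by
  constructor
  · intro h
    obtain ⟨ε, hε, h⟩ := h.exists_forall_le
    obtain ⟨r, hr, hb⟩ := Metric.nhds_basis_closedBall.mem_iff.1
      (((chartAt E (c t)).open_source.preimage hc).mem_nhds (mem_chart_source E (c t)))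
    rw [Real.closedBall_eq_Icc] at hb
    refine ⟨min ε r, lt_min hε hr, ?_, ?_⟩
    · intro s hs
      exact hb ⟨by linarith [hs.1, min_le_right ε r], by linarith [hs.2, min_le_right ε r]⟩
    · simp_rw [Cover.chartAt_apply]
      exact (h _ (lt_min hε hr) (min_le_left _ _)).2
  · rintro ⟨ε, hε, h1, h2⟩
    simp_rw [Cover.chartAt_apply] at h2
    exact ⟨ε, hε, fun s hs => Cover.proj_mem_chartAt_source (h1 hs), h2⟩

theorem Cover.mdifferentiableAt_of_proj {c : ℝ → Cover G} (hc : Continuous c) {s : ℝ}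
    (h : MDifferentiableAt 𝓘(ℝ, ℝ) 𝓘(ℝ, E) (fun s => (c s).proj) s) :
    MDifferentiableAt 𝓘(ℝ, ℝ) 𝓘(ℝ, E) c s := by
  rw [mdifferentiableAt_iff] at h ⊢
  refine ⟨hc.continuousAt, h.2.congr_of_eventuallyEq (.of_forall fun z => ?_) ?_⟩ <;>
    exact Cover.chartAt_apply _ _

theorem Cover.tangentMap_scaledVelocity [IsManifold 𝓘(ℝ, E) ∞ M] {c : ℝ → Cover G}
    (hc : Continuous c) (s x : ℝ) :
    tangentMap 𝓘(ℝ, E) 𝓘(ℝ, E) Cover.proj (scaledVelocity (E := E) c s x)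
      = scaledVelocity (fun s => (c s).proj) s x := by
  by_cases h : MDifferentiableAt 𝓘(ℝ, ℝ) 𝓘(ℝ, E) c s
  · exact (tangentMap_comp_at (⟨s, x⟩ : TangentBundle 𝓘(ℝ, ℝ) ℝ)
      ((Cover.contMDiff_proj (c s)).mdifferentiableAt (by simp)) h).symm
  -- If the curve is not differentiable, neither is its projection, and both velocities are zero by
  -- convention.
  · refine congrArg (Bundle.TotalSpace.mk (c s).proj) ?_
    change mfderiv 𝓘(ℝ, E) 𝓘(ℝ, E) Cover.proj (c s) (mfderiv 𝓘(ℝ, ℝ) 𝓘(ℝ, E) c s x)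
      = mfderiv 𝓘(ℝ, ℝ) 𝓘(ℝ, E) (fun s => (c s).proj) s x
    rw [mfderiv_zero_of_not_mdifferentiableAt h, mfderiv_zero_of_not_mdifferentiableAt
      (mt (Cover.mdifferentiableAt_of_proj hc) h)]
    exact map_zero (mfderiv 𝓘(ℝ, E) 𝓘(ℝ, E) Cover.proj (c s))

theorem Cover.extend_map_proj {x y : Cover G} (γ : Path x y) :
    (γ.map Cover.continuous_proj).extend = fun s => (γ.extend s).proj := rfl

theorem Cover.isH1_map_proj_iff {x y : Cover G} {γ : Path x y} :
    IsH1 (E := E) (γ.map Cover.continuous_proj) ↔ IsH1 (E := E) γ := by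
  simp_rw [isH1_iff, Cover.extend_map_proj, Cover.isH1At_proj_iff γ.continuous_extend]

variable [IsManifold 𝓘(ℝ, E) ∞ M]

theorem action_liftLagrangian (L : TangentBundle 𝓘(ℝ, E) M → ℝ) (k : ℝ) {x y : Cover G}
    (γ : Path x y) (T : ℝ) : action (liftLagrangian L G) k γ T
      = action L k (γ.map Cover.continuous_proj) T := by
  simp_rw [action_eq, Cover.extend_map_proj, liftLagrangian,
    Cover.tangentMap_scaledVelocity γ.continuous_extend]

theorem criticalValue_liftLagrangian_le (L : TangentBundle 𝓘(ℝ, E) M → ℝ)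
    (G : Subgroup (FundamentalGroup M m)) : criticalValue (liftLagrangian L G) ≤ criticalValue L :=
  sInf_le_sInf (image_mono fun k hk x γ hγ T hT => by
    rw [action_liftLagrangian]
    exact hk _ _ (Cover.isH1_map_proj_iff.2 hγ) T hT)

theorem criticalValueUniversal_le_criticalValue_liftLagrangian [ConnectedSpace M]
    (L : TangentBundle 𝓘(ℝ, E) M → ℝ) (G : Subgroup (FundamentalGroup M m)) :
    criticalValueUniversal L ≤ criticalValue (liftLagrangian L G) := by
  refine sInf_le_sInf (image_mono fun k hk q γ hγ hγ0 T hT => ?_)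
  have := ChartedSpace.locallyPathConnectedSpace E M
  have : PathConnectedSpace M := pathConnectedSpace_iff_connectedSpace.2 inferInstance
  let x : Cover G :=
    ⟨q, Quotient.mk _ (Path.Homotopic.Quotient.mk (PathConnectedSpace.somePath m q))⟩
  -- The lift closes up: its endpoint depends only on the homotopy class of `γ`, which is trivial.
  have hx : x = x.move γ := by rw [x.move_congr (q := q) hγ0, x.move_refl]
  let γ' : Path x x := (x.liftPath γ).cast rfl hx
  have hγ' : γ'.map Cover.continuous_proj = γ := by
    ext t
    rfl
  have h := hk x γ' (Cover.isH1_map_proj_iff.1 (by rwa [hγ'])) T hT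
  rwa [action_liftLagrangian, hγ'] at h

end CoverSmooth

/-- On the ray `t ↦ t • u` the Hessian bound is integrated twice, each time as monotonicity of the
difference from the comparison polynomial. -/
theorem taylor_lower_bound {F : Type*} [NormedAddCommGroup F] [NormedSpace ℝ F] {f : F → ℝ}
    (hf : ContDiff ℝ 2 f) {a : ℝ}
    (h : ∀ v u : F, 2 * a * ‖u‖ ^ 2 ≤ fderiv ℝ (fderiv ℝ f) v u u) (u : F) :
    f 0 + fderiv ℝ f 0 u + a * ‖u‖ ^ 2 ≤ f u := by
  have hf' : ContDiff ℝ 1 (fderiv ℝ f) := hf.fderiv_right (by norm_num)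
  have hl : ∀ t : ℝ, HasDerivAt (fun t : ℝ => t • u) u t := fun t => by
    simpa using (hasDerivAt_id t).smul_const u
  have hg : ∀ t : ℝ, HasDerivAt (fun t : ℝ => f (t • u)) (fderiv ℝ f (t • u) u) t := fun t =>
    ((hf.differentiable (by simp)) _).hasFDerivAt.comp_hasDerivAt t (hl t)
  have hg' : ∀ t : ℝ, HasDerivAt (fun t : ℝ => fderiv ℝ f (t • u) u)
      (fderiv ℝ (fderiv ℝ f) (t • u) u u) t := fun t =>
    ((ContinuousLinearMap.apply ℝ ℝ u).hasFDerivAt).comp_hasDerivAt t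
      (((hf'.differentiable (by simp)) _).hasFDerivAt.comp_hasDerivAt t (hl t))
  have hp : Monotone fun t : ℝ => fderiv ℝ f (t • u) u - 2 * a * ‖u‖ ^ 2 * t := by
    have hd : ∀ t : ℝ, HasDerivAt (fun t : ℝ => fderiv ℝ f (t • u) u - 2 * a * ‖u‖ ^ 2 * t)
        (fderiv ℝ (fderiv ℝ f) (t • u) u u - 2 * a * ‖u‖ ^ 2) t := fun t => by
      have h' := (hg' t).sub ((hasDerivAt_id' t).const_mul (2 * a * ‖u‖ ^ 2))
      rw [mul_one] at h'
      exact h'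
    refine monotone_of_deriv_nonneg (fun t => (hd t).differentiableAt) fun t => ?_
    rw [(hd t).deriv, sub_nonneg]
    exact h _ _
  have hd : ∀ t : ℝ, HasDerivAt
      (fun t : ℝ => f (t • u) - fderiv ℝ f 0 u * t - a * ‖u‖ ^ 2 * t ^ 2)
      (fderiv ℝ f (t • u) u - fderiv ℝ f 0 u - a * ‖u‖ ^ 2 * (2 * t)) t := fun t => by
    have h' := ((hg t).sub ((hasDerivAt_id' t).const_mul (fderiv ℝ f 0 u))).sub
      ((hasDerivAt_pow 2 t).const_mul (a * ‖u‖ ^ 2))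
    simp only [mul_one, Nat.cast_ofNat, Nat.add_one_sub_one, pow_one] at h'
    exact h'
  have hr : MonotoneOn (fun t : ℝ => f (t • u) - fderiv ℝ f 0 u * t - a * ‖u‖ ^ 2 * t ^ 2)
      (Ici 0) := by
    refine monotoneOn_of_deriv_nonneg (convex_Ici 0)
      (fun t _ => (hd t).continuousAt.continuousWithinAt)
      (fun t _ => (hd t).differentiableAt.differentiableWithinAt) fun t ht => ?_
    rw [interior_Ici] at ht
    rw [(hd t).deriv]
    have := hp (le_of_lt ht)
    simp only [zero_smul, mul_zero, sub_zero] at this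
    linarith
  have := hr self_mem_Ici (mem_Ici.2 zero_le_one) zero_le_one
  simp only [zero_smul, one_smul] at this
  linarith

/-! ### Constant loops, rest energy, and the one-form of mechanical Lagrangians -/

section RestPoints

variable {E : Type*} [NormedAddCommGroup E] [NormedSpace ℝ E]
  {M : Type*} [TopologicalSpace M] [ChartedSpace E M]

theorem action_refl (L : TangentBundle 𝓘(ℝ, E) M → ℝ) (k : ℝ) (q : M) (T : ℝ) :
    action L k (Path.refl q) T = T * (L ⟨q, 0⟩ + k) := by
  have h : ∀ s x : ℝ, scaledVelocity (E := E) (fun _ : ℝ => q) s x = ⟨q, 0⟩ := fun s x => by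
    refine congrArg (Bundle.TotalSpace.mk q) ?_
    change mfderiv 𝓘(ℝ, ℝ) 𝓘(ℝ, E) (fun _ : ℝ => q) s x = 0
    rw [mfderiv_const]
    rfl
  have h' : ∀ s, L (scaledVelocity (Path.refl q).extend s T⁻¹) = L ⟨q, 0⟩ :=
    fun s => congrArg L (h s T⁻¹)
  simp_rw [action_eq, h']
  simp

theorem energy_zero (L : TangentBundle 𝓘(ℝ, E) M → ℝ) (q : M) : energy L q 0 = -L ⟨q, 0⟩ := by
  rw [energy, map_zero, zero_sub]

variable [Bundle.RiemannianBundle (fun x : M => TangentSpace 𝓘(ℝ, E) x)]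
  {L : TangentBundle 𝓘(ℝ, E) M → ℝ}

theorem HasQuadraticGrowth.energy_le_maxRestEnergy (h : HasQuadraticGrowth L) (q : M) :
    energy L q 0 ≤ maxRestEnergy L := by
  obtain ⟨a, -, b, A, B, h⟩ := h
  -- The quadratic lower bound at `v = 0` gives `E(q,0) = -L(q,0) ≤ b`, so the supremum is finite.
  refine le_ciSup (f := fun q : M => energy L q 0) ⟨b, ?_⟩ q
  rintro _ ⟨q, rfl⟩
  have := (h q 0).1
  simp only [norm_zero, energy_zero] at *
  linarith

theorem IsMechanical.fiberDeriv_zero (h : IsMechanical L) (q : M) : fiberDeriv L q 0 = 0 := by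
  obtain ⟨V, -, h⟩ := h
  refine IsLocalMin.fderiv_eq_zero (.of_forall fun v => ?_)
  simp only [h, norm_zero]
  nlinarith [sq_nonneg ‖v‖]

theorem magneticNorm_eq_zero (h : ∀ q : M, fiberDeriv L q 0 = 0) : magneticNorm L = 0 := by
  have h' : ∀ q : M, ‖fiberDeriv L q 0‖ = 0 := fun q => by
    rw [h q]
    exact norm_zero (E := TangentSpace 𝓘(ℝ, E) q →L[ℝ] ℝ)
  simp only [magneticNorm, h', Real.iSup_const_zero]

end RestPoints

/-! ### Smoothness along the fibres, and the two ends of the chain -/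

section Fibers

variable {E : Type*} [NormedAddCommGroup E] [NormedSpace ℝ E]
  {M : Type*} [TopologicalSpace M] [ChartedSpace E M] [IsManifold 𝓘(ℝ, E) ∞ M]

theorem contMDiff_fiberInclusion (q : M) :
    ContMDiff 𝓘(ℝ, E) 𝓘(ℝ, E).tangent ∞
      (fun w : E => (⟨q, w⟩ : TangentBundle 𝓘(ℝ, E) M)) := by
  intro w
  rw [Bundle.contMDiffAt_totalSpace]
  refine ⟨contMDiffAt_const, ?_⟩
  have hq : q ∈ (trivializationAt E (TangentSpace 𝓘(ℝ, E) : M → Type _) q).baseSet :=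
    FiberBundle.mem_baseSet_trivializationAt' q
  let l : E →L[ℝ] E := (trivializationAt E (TangentSpace 𝓘(ℝ, E) : M → Type _)
    q).continuousLinearMapAt ℝ q
  have hl : ContMDiffAt 𝓘(ℝ, E) 𝓘(ℝ, E) ∞ l w := l.contDiff.contMDiff w
  refine hl.congr_of_eventuallyEq (.of_forall fun v => ?_)
  exact (Bundle.Trivialization.continuousLinearMapAt_apply_of_mem ℝ _ hq v).symm

theorem contDiff_fiber {L : TangentBundle 𝓘(ℝ, E) M → ℝ}
    (hL : ContMDiff 𝓘(ℝ, E).tangent 𝓘(ℝ, ℝ) ∞ L) (q : M) :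
    ContDiff ℝ ∞ (fun w : E => L ⟨q, w⟩) :=
  (hL.comp (contMDiff_fiberInclusion q)).contDiff

theorem isH1_refl [CompleteSpace E] (q : M) : IsH1 (E := E) (Path.refl q) := by
  have h : ContMDiff 𝓘(ℝ, ℝ) 𝓘(ℝ, E) ∞ (Path.refl q).extend :=
    contMDiff_const (c := q)
  exact fun t _ => isH1At_of_contMDiff h t

theorem maxRestEnergy_le_criticalValueUniversal [CompleteSpace E] [Nonempty M]
    (L : TangentBundle 𝓘(ℝ, E) M → ℝ) : (maxRestEnergy L : EReal) ≤ criticalValueUniversal L := by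
  refine le_sInf ?_
  rintro _ ⟨k, hk, rfl⟩
  refine EReal.coe_le_coe (ciSup_le fun q => ?_)
  have := hk q (Path.refl q) (isH1_refl q) (.refl _) 1 one_pos
  rw [action_refl] at this
  rw [energy_zero]
  linarith

variable [Bundle.RiemannianBundle (fun x : M => TangentSpace 𝓘(ℝ, E) x)]
  {L : TangentBundle 𝓘(ℝ, E) M → ℝ}

/-- The fibre carries the Riemannian norm instead of that of `E`; the identity is continuous linear
between the two, so smoothness carries over. -/
theorem contDiff_fiber_riemannian (hL : ContMDiff 𝓘(ℝ, E).tangent 𝓘(ℝ, ℝ) ∞ L) (q : M) :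
    ContDiff ℝ ∞ (fun w : TangentSpace 𝓘(ℝ, E) q => L ⟨q, w⟩) := by
  let l : TangentSpace 𝓘(ℝ, E) q →L[ℝ] E := ContinuousLinearMap.id ℝ E
  exact (contDiff_fiber hL q).comp l.contDiff

theorem lagrangian_lower_bound (hL : ContMDiff 𝓘(ℝ, E).tangent 𝓘(ℝ, ℝ) ∞ L) {a : ℝ}
    (hconv : ∀ (q : M) (v u : TangentSpace 𝓘(ℝ, E) q), 2 * a * ‖u‖ ^ 2 ≤ fiberHess L q v u u)
    (q : M) (v : TangentSpace 𝓘(ℝ, E) q) :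
    L ⟨q, 0⟩ + fiberDeriv L q 0 v + a * ‖v‖ ^ 2 ≤ L ⟨q, v⟩ :=
  taylor_lower_bound (f := fun w : TangentSpace 𝓘(ℝ, E) q => L ⟨q, w⟩)
    ((contDiff_fiber_riemannian hL q).of_le (WithTop.coe_le_coe.2 le_top)) (hconv q) v

theorem HasQuadraticGrowth.norm_fiberDeriv_le_magneticNorm (h : HasQuadraticGrowth L)
    (hL : ContMDiff 𝓘(ℝ, E).tangent 𝓘(ℝ, ℝ) ∞ L) {a : ℝ}
    (hconv : ∀ (q : M) (v u : TangentSpace 𝓘(ℝ, E) q), 2 * a * ‖u‖ ^ 2 ≤ fiberHess L q v u u)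
    (q : M) : ‖fiberDeriv L q 0‖ ≤ magneticNorm L := by
  obtain ⟨_, _, b, A, B, h⟩ := h
  -- On unit vectors the Taylor bound and the growth bounds give `θ(v) ≤ A + B + b - a`. The maximum
  -- with `0` supplies the nonnegativity that an operator norm bound requires.
  refine le_ciSup (f := fun q : M => ‖fiberDeriv L q 0‖) ⟨max (A + B + b - a) 0, ?_⟩ q
  rintro _ ⟨q, rfl⟩
  have key : ∀ v : TangentSpace 𝓘(ℝ, E) q, ‖v‖ = 1 → fiberDeriv L q 0 v ≤ A + B + b - a := by
    intro v hv
    have h1 := lagrangian_lower_bound hL hconv q v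
    have h2 := (h q v).2
    have h3 := (h q 0).1
    rw [hv] at h1 h2
    rw [norm_zero] at h3
    linarith
  refine ContinuousLinearMap.opNorm_le_of_unit_norm (le_max_right _ _) fun v hv => ?_
  refine le_max_of_le_left (abs_le'.2 ⟨key v hv, ?_⟩)
  rw [← map_neg]
  exact key (-v) (by rwa [norm_neg])

theorem criticalValuePaths_le (hquad : HasQuadraticGrowth L)
    (hL : ContMDiff 𝓘(ℝ, E).tangent 𝓘(ℝ, ℝ) ∞ L) {a : ℝ} (ha : 0 < a)
    (hconv : ∀ (q : M) (v u : TangentSpace 𝓘(ℝ, E) q), 2 * a * ‖u‖ ^ 2 ≤ fiberHess L q v u u)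
    (Q₀ Q₁ : Set M) : criticalValuePaths L Q₀ Q₁
      ≤ ((maxRestEnergy L + magneticNorm L ^ 2 / (4 * a) : ℝ) : EReal) := by
  refine sInf_le ⟨_, fun q₀ _ q₁ _ γ _ T hT => ?_, rfl⟩
  -- The integrand is nonnegative pointwise, so no integrability is needed.
  refine mul_nonneg hT.le (intervalIntegral.integral_nonneg zero_le_one fun s _ => ?_)
  set q := γ.extend s
  set v : TangentSpace 𝓘(ℝ, E) q := T⁻¹ • velocity γ s
  have h1 := lagrangian_lower_bound hL hconv q v
  have h2 := hquad.energy_le_maxRestEnergy q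
  have h3 := hquad.norm_fiberDeriv_le_magneticNorm hL hconv q
  have h4 : -(magneticNorm L * ‖v‖) ≤ fiberDeriv L q 0 v :=
    (abs_le.1 (((fiberDeriv L q 0).le_opNorm v).trans
      (mul_le_mul_of_nonneg_right h3 (norm_nonneg v)))).1
  have h5 : magneticNorm L ^ 2 / (4 * a) - magneticNorm L * ‖v‖ + a * ‖v‖ ^ 2
      = (magneticNorm L - 2 * a * ‖v‖) ^ 2 / (4 * a) := by
    field_simp
    ring
  have h6 : 0 ≤ (magneticNorm L - 2 * a * ‖v‖) ^ 2 / (4 * a) := by positivity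
  rw [energy_zero] at h2
  linarith

end Fibers

end ManeChain

theorem mainTheorem8
    {E : Type*} [NormedAddCommGroup E] [NormedSpace ℝ E] [FiniteDimensional ℝ E]
    {M : Type*} [TopologicalSpace M] [ChartedSpace E M] [IsManifold 𝓘(ℝ, E) ∞ M]
    [T2Space M] [CompactSpace M] [ConnectedSpace M]
    [Bundle.RiemannianBundle (fun x : M => TangentSpace 𝓘(ℝ, E) x)]
    [IsContMDiffRiemannianBundle 𝓘(ℝ, E) ∞ E (fun x : M => TangentSpace 𝓘(ℝ, E) x)]
    (L : TangentBundle 𝓘(ℝ, E) M → ℝ)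
    (hL : ManeChain.IsTonelli L) (hquad : ManeChain.HasQuadraticGrowth L)
    (a : ℝ) (ha : 0 < a)
    (hconv : ∀ (q : M) (v u : TangentSpace 𝓘(ℝ, E) q),
      2 * a * ‖u‖ ^ 2 ≤ ManeChain.fiberHess L q v u u)
    (Q₀ Q₁ : Set M)
    (hQ₀ : ManeChain.IsClosedSubmanifold E Q₀) (hQ₁ : ManeChain.IsClosedSubmanifold E Q₁)
    (hne₀ : Q₀.Nonempty) (hne₁ : Q₁.Nonempty) (m : M) :
    ((ManeChain.maxRestEnergy L : EReal) ≤ ManeChain.criticalValueUniversal L ∧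
      ManeChain.criticalValueUniversal L ≤ ManeChain.criticalValuePair L m Q₀ Q₁ ∧
      ManeChain.criticalValuePair L m Q₀ Q₁ ≤ ManeChain.criticalValue L ∧
      ManeChain.criticalValue L ≤ ManeChain.criticalValuePaths L Q₀ Q₁ ∧
      ManeChain.criticalValuePaths L Q₀ Q₁ ≤
        ((ManeChain.maxRestEnergy L + ManeChain.magneticNorm L ^ 2 / (4 * a) : ℝ) : EReal)) ∧
    ((∀ q : M, ManeChain.fiberDeriv L q 0 = 0) ∨ ManeChain.IsMechanical L →
      (ManeChain.maxRestEnergy L : EReal) = ManeChain.criticalValueUniversal L ∧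
      ManeChain.criticalValueUniversal L = ManeChain.criticalValuePair L m Q₀ Q₁ ∧
      ManeChain.criticalValuePair L m Q₀ Q₁ = ManeChain.criticalValue L ∧
      ManeChain.criticalValue L = ManeChain.criticalValuePaths L Q₀ Q₁) := by
  have : CompleteSpace E := FiniteDimensional.complete ℝ E
  have h1 := ManeChain.maxRestEnergy_le_criticalValueUniversal L
  have h2 : ManeChain.criticalValueUniversal L ≤ ManeChain.criticalValuePair L m Q₀ Q₁ :=
    ManeChain.criticalValueUniversal_le_criticalValue_liftLagrangian L _
  have h3 : ManeChain.criticalValuePair L m Q₀ Q₁ ≤ ManeChain.criticalValue L :=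
    ManeChain.criticalValue_liftLagrangian_le L _
  have h4 : ManeChain.criticalValue L ≤ ManeChain.criticalValuePaths L Q₀ Q₁ :=
    ManeChain.criticalValue_le_criticalValuePaths hL.smooth.continuous hne₀ hne₁
  have h5 := ManeChain.criticalValuePaths_le hquad hL.smooth ha hconv Q₀ Q₁
  refine ⟨⟨h1, h2, h3, h4, h5⟩, fun h => ?_⟩
  have hθ : ∀ q : M, ManeChain.fiberDeriv L q 0 = 0 :=
    h.elim id ManeChain.IsMechanical.fiberDeriv_zero
  rw [ManeChain.magneticNorm_eq_zero hθ, zero_pow two_ne_zero, zero_div, add_zero] at h5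
  -- For `θ = 0` this closes the chain into a cycle, so all inequalities are equalities.
  have h41 := h5.trans h1
  exact ⟨h1.antisymm (h2.trans (h3.trans (h4.trans h5))),
    h2.antisymm (h3.trans (h4.trans h41)), h3.antisymm (h4.trans (h41.trans h2)),
    h4.antisymm (h41.trans (h2.trans h3))⟩
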